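/- For a positive integer $t$, the $t$-broom is the graph obtained from the star $K_{1,t+1}$ by subdividing one edge once. A graph is $H$-free if it has no induced subgraph isomorphic to $H$; $\chi(G)$ and $\omega(G)$ denote the chromatic number and the clique number of $G$. Let $t\ge 3$ be an integer. For all finite graphs $G$ that are both $t$-broom-free and $K_{t,t}$-free, $$\chi(G)=o\left(\omega(G)^{\,t-1+\frac{2}{t+1}}\right),$$ that is, there is a function $g:\mathbb{N}\to\mathbb{N}$, depending only on $t$, such that $g(n)=o\bigl(n^{\,t-1+\frac{2}{t+1}}\bigr)$ as $n\to\infty$ and $\chi(G)\le g(\omega(G))$ for every finite graph $G$ that is both $t$-broom-free and $K_{t,t}$-free. -/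

import Mathlib

open Filter Asymptotics

/-- The vertices of the `t`-broom `(u₀, v₁v₂, {u₁, …, uₜ})`: the vertex `u₀` of degree `t + 1`,
the subdividing vertex `v₁`, the pendant vertex `v₂` beyond it, and the leaves `u₁, …, uₜ`. -/
inductive BroomVertex (t : ℕ) : Type
  | u₀ : BroomVertex t
  | v₁ : BroomVertex t
  | v₂ : BroomVertex t
  | leaf (i : Fin t) : BroomVertex t

/-- One orientation of each edge of the `t`-broom: `u₀v₁`, `v₁v₂` and `u₀uᵢ` for each `i`. -/
inductive BroomEdge (t : ℕ) : BroomVertex t → BroomVertex t → Prop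
  | u₀_v₁ : BroomEdge t .u₀ .v₁
  | v₁_v₂ : BroomEdge t .v₁ .v₂
  | u₀_leaf (i : Fin t) : BroomEdge t .u₀ (.leaf i)

/-- The `t`-broom: the graph obtained from the star `K_{1,t+1}` with centre `u₀` and leaves
`v₂, u₁, …, uₜ` by subdividing the edge `u₀v₂` once, with new vertex `v₁`. -/
def broom (t : ℕ) : SimpleGraph (BroomVertex t) :=
  SimpleGraph.fromRel (BroomEdge t)

/-- `G` is `H`-free: no induced subgraph of `G` is isomorphic to `H`. -/
def InducedFree {W V : Type*} (H : SimpleGraph W) (G : SimpleGraph V) : Prop :=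
  ¬ H.IsIndContained G

/-! The stronger bound `χ ≤ K * ω ^ (t - 1) + 1` holds, because every induced subgraph has a vertex
of degree at most `K * ω ^ (t - 1)` and so greedy colouring applies.

Let `v` have minimum degree in the subgraph on `A`, with neighbourhood `N`. If `N` has no
independent `(2t - 1)`-set, then excluding `K_{t,t}` gives `|N| = O(ω ^ (t - 1))`
(`card_le_of_completeBipartite_free`). Otherwise fix such a set `S`. By broom-freeness, each vertex
of `C` (non-neighbours of `v` touching `S`) and of `X` (vertices of `N` with a neighbour outside `N
∪ C ∪ {v}`) has `t` neighbours in `S`. Counting over `t`-subsets of `S` gives `|C| = O(ω ^ (t - 2))`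
and `|X| = O(ω ^ (t - 1))`. A vertex of `N \ X` has all its neighbours in `N ∪ C ∪ {v}` and degree
at least `|N|`, so it misses at most `|C| + 1` vertices of `N`; hence `|N \ X| ≤ ω (|C| + 1)`. -/

lemma isIndepSet_coe_insert {V : Type*} [DecidableEq V] {G : SimpleGraph V} {I : Finset V} {q : V}
    (hI : G.IsIndepSet (I : Set V)) (hq : ∀ b ∈ I, ¬ G.Adj q b) :
    G.IsIndepSet ((insert q I : Finset V) : Set V) := by
  intro a ha b hb hab
  rcases Finset.mem_insert.1 ha with rfl | haI <;> rcases Finset.mem_insert.1 hb with rfl | hbI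
  · exact absurd rfl hab
  · exact hq b hbI
  · exact fun h => hq a haI h.symm
  · exact hI haI hbI hab

/-! ### Ramsey-type counting bounds -/

/-- `Y` is covered by the sets of common neighbours of the `t`-subsets of `S`. -/
lemma card_le_choose_mul_of_many_adj {V : Type*} [DecidableEq V] {G : SimpleGraph V}
    [DecidableRel G.Adj] {t k : ℕ} {S Y : Finset V}
    (hY : ∀ y ∈ Y, t ≤ (S.filter (G.Adj y)).card)
    (hT : ∀ T ⊆ S, T.card = t → (Y.filter fun y => ∀ x ∈ T, G.Adj y x).card ≤ k) :
    Y.card ≤ S.card.choose t * k := by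
  have hsub : Y ⊆ (S.powersetCard t).biUnion
      (fun T => Y.filter fun y => ∀ x ∈ T, G.Adj y x) := by
    intro y hy
    obtain ⟨T, hTs, hTc⟩ := Finset.exists_subset_card_eq (hY y hy)
    simp only [Finset.mem_biUnion, Finset.mem_powersetCard, Finset.mem_filter]
    exact ⟨T, ⟨hTs.trans (Finset.filter_subset _ _), hTc⟩, hy,
      fun x hx => (Finset.mem_filter.1 (hTs hx)).2⟩
  rw [← Finset.card_powersetCard]
  refine (Finset.card_le_card hsub).trans (Finset.card_biUnion_le_card_mul _ _ _ ?_)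
  intro T hTm
  rw [Finset.mem_powersetCard] at hTm
  exact hT T hTm.1 hTm.2

/-- A set in which every vertex has at most `k` non-neighbours (itself included) has at most
`ω * k` vertices. -/
lemma card_le_mul_of_card_not_adj_le {V : Type*} [DecidableEq V] {G : SimpleGraph V}
    [DecidableRel G.Adj] {w k : ℕ}
    (hw : ∀ Q : Finset V, G.IsClique (Q : Set V) → Q.card ≤ w) {A : Finset V}
    (hk : ∀ q ∈ A, (A.filter fun x => ¬ G.Adj q x).card ≤ k) :
    A.card ≤ w * k := by
  classical
  -- By maximality of `Q`, every vertex of `A` has a non-neighbour in `Q`, so the non-neighbourhoods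
  -- cover `A`.
  obtain ⟨Q, hQ, hmax⟩ := Finset.exists_max_image
    (A.powerset.filter fun Q : Finset V => G.IsClique (Q : Set V)) (fun Q => Q.card) ⟨∅, by simp⟩
  simp only [Finset.mem_filter, Finset.mem_powerset] at hQ hmax
  have hsub : A ⊆ Q.biUnion (fun q => A.filter fun x => ¬ G.Adj q x) := by
    intro x hx
    by_contra hcon
    simp only [Finset.mem_biUnion, Finset.mem_filter, not_exists, not_and, not_not] at hcon
    have hxQ : x ∉ Q := fun h => G.loopless.irrefl x (hcon x h hx)
    have h := hmax (insert x Q) ⟨Finset.insert_subset hx hQ.1, by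
      rw [Finset.coe_insert, SimpleGraph.isClique_insert]
      exact ⟨hQ.2, fun b hb _ => (hcon b hb hx).symm⟩⟩
    rw [Finset.card_insert_of_notMem hxQ] at h
    omega
  calc A.card ≤ _ := Finset.card_le_card hsub
    _ ≤ Q.card * k := Finset.card_biUnion_le_card_mul _ _ _ fun q hq => hk q (hQ.1 hq)
    _ ≤ w * k := Nat.mul_le_mul_right _ (hw Q hQ.2)

/-- A polynomial Ramsey bound for a fixed independence number. -/
lemma card_le_mul_pow_of_not_isIndepSet {V : Type*} [DecidableEq V] {G : SimpleGraph V}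
    [DecidableRel G.Adj] {w : ℕ} (hw1 : 1 ≤ w)
    (hw : ∀ Q : Finset V, G.IsClique (Q : Set V) → Q.card ≤ w) (s : ℕ) :
    ∀ A : Finset V, (∀ I ⊆ A, I.card = s + 1 → ¬ G.IsIndepSet (I : Set V)) →
      A.card ≤ s * w ^ s := by
  induction s with
  | zero =>
    intro A hA
    rcases A.eq_empty_or_nonempty with rfl | ⟨a, ha⟩
    · simp
    · exact absurd (by simp [SimpleGraph.IsIndepSet]) (hA {a} (by simpa using ha) (by simp))
  | succ s ih =>
    intro A hA
    have hk : ∀ q ∈ A, (A.filter fun x => ¬ G.Adj q x).card ≤ s * w ^ s + 1 := by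
      intro q hq
      have hq' : q ∈ A.filter fun x => ¬ G.Adj q x := by simp [hq]
      rw [← Finset.card_erase_add_one hq']
      gcongr
      refine ih _ fun I hI hIc hind => ?_
      have hqI : q ∉ I := fun h => (Finset.mem_erase.1 (hI h)).1 rfl
      refine hA (insert q I) ?_ (by rw [Finset.card_insert_of_notMem hqI, hIc]) ?_
      · refine Finset.insert_subset hq fun x hx => ?_
        exact (Finset.mem_filter.1 (Finset.mem_erase.1 (hI hx)).2).1
      · exact isIndepSet_coe_insert hind
          fun b hb => (Finset.mem_filter.1 (Finset.mem_erase.1 (hI hb)).2).2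
    calc A.card ≤ w * (s * w ^ s + 1) := card_le_mul_of_card_not_adj_le hw hk
      _ = s * w ^ (s + 1) + w ^ 1 := by ring
      _ ≤ s * w ^ (s + 1) + w ^ (s + 1) := by
        exact Nat.add_le_add_left (Nat.pow_le_pow_right hw1 (by omega)) _
      _ = (s + 1) * w ^ (s + 1) := by ring

/-! ### Consequences of the forbidden subgraphs -/

lemma InducedFree.not_completeBipartite {V : Type*} {G : SimpleGraph V} {t : ℕ}
    (h : InducedFree (completeBipartiteGraph (Fin t) (Fin t)) G) {S T : Finset V}
    (hS : S.card = t) (hT : T.card = t) (hSi : G.IsIndepSet (S : Set V))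
    (hTi : G.IsIndepSet (T : Set V)) (hST : ∀ x ∈ S, ∀ y ∈ T, G.Adj x y) : False := by
  classical
  let e := (S.equivFinOfCardEq hS).symm
  let f := (T.equivFinOfCardEq hT).symm
  have hne : ∀ i j, (e i : V) ≠ f j := fun i j => (hST _ (e i).2 _ (f j).2).ne
  let F : Fin t ⊕ Fin t → V := Sum.elim (fun i => (e i : V)) (fun j => (f j : V))
  have hF : ∀ p q, G.Adj (F p) (F q) ↔ (completeBipartiteGraph (Fin t) (Fin t)).Adj p q := by
    rintro (i | i) (j | j)
    · have : ¬ G.Adj (e i : V) (e j) := fun ha => hSi (e i).2 (e j).2 ha.ne ha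
      simpa [F] using this
    · simpa [F] using hST _ (e i).2 _ (f j).2
    · simpa [F] using (hST _ (e j).2 _ (f i).2).symm
    · have : ¬ G.Adj (f i : V) (f j) := fun ha => hTi (f i).2 (f j).2 ha.ne ha
      simpa [F] using this
  refine h ⟨⟨⟨F, ?_⟩, hF _ _⟩⟩
  rintro (i | i) (j | j) hij
  · simpa [F, Subtype.ext_iff] using hij
  · exact absurd hij (hne i j)
  · exact absurd hij.symm (hne j i)
  · simpa [F, Subtype.ext_iff] using hij

/-- Here `v` is the centre, `a` the subdividing vertex, `y` the pendant end and `T` the leaves; that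
`a` and `y` lie outside `T` follows from the adjacencies. -/
lemma InducedFree.not_broom {V : Type*} {G : SimpleGraph V} {t : ℕ}
    (h : InducedFree (broom t) G) {v a y : V} {T : Finset V} (hT : T.card = t)
    (hTi : G.IsIndepSet (T : Set V)) (hva : G.Adj v a) (hay : G.Adj a y) (hvy : ¬ G.Adj v y)
    (hne : v ≠ y) (hvT : ∀ x ∈ T, G.Adj v x) (haT : ∀ x ∈ T, ¬ G.Adj a x)
    (hyT : ∀ x ∈ T, ¬ G.Adj y x) : False := by
  classical
  let e := (T.equivFinOfCardEq hT).symm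
  have hve : ∀ i, G.Adj v (e i) := fun i => hvT _ (e i).2
  have hae : ∀ i, ¬ G.Adj a (e i) := fun i => haT _ (e i).2
  have hye : ∀ i, ¬ G.Adj y (e i) := fun i => hyT _ (e i).2
  have hee : ∀ i j, ¬ G.Adj (e i : V) (e j) := fun i j ha => hTi (e i).2 (e j).2 ha.ne ha
  have hvy' : ¬ G.Adj y v := fun h => hvy h.symm
  have hae' : ∀ i, ¬ G.Adj (e i : V) a := fun i h => hae i h.symm
  have hye' : ∀ i, ¬ G.Adj (e i : V) y := fun i h => hye i h.symm
  have hane : ∀ i, a ≠ (e i : V) := fun i hi => hye i (hi ▸ hay.symm)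
  have hyne : ∀ i, y ≠ (e i : V) := fun i hi => hvy (hi ▸ hve i)
  let F : BroomVertex t → V := fun b => match b with
    | .u₀ => v
    | .v₁ => a
    | .v₂ => y
    | .leaf i => e i
  have hE : ∀ p q, BroomEdge t p q ↔
      (p = .u₀ ∧ q = .v₁) ∨ (p = .v₁ ∧ q = .v₂) ∨ (p = .u₀ ∧ ∃ i, q = .leaf i) := by
    intro p q
    constructor
    · rintro (_ | _ | i) <;> simp
    · rintro (⟨rfl, rfl⟩ | ⟨rfl, rfl⟩ | ⟨rfl, i, rfl⟩) <;> constructor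
  have hF : ∀ p q, G.Adj (F p) (F q) ↔ (broom t).Adj p q := by
    rintro (_ | _ | _ | i) (_ | _ | _ | j) <;>
      simp [broom, hE, F, hva, hva.symm, hay, hay.symm, hvy, hvy', hve, (hve _).symm,
        hae, hae', hye, hye', hee]
  refine h ⟨⟨⟨F, ?_⟩, hF _ _⟩⟩
  · rintro (_ | _ | _ | i) (_ | _ | _ | j) hij <;> simp only [F] at hij
    · rfl
    · exact absurd hij hva.ne
    · exact absurd hij hne
    · exact absurd hij (hve j).ne
    · exact absurd hij hva.ne'
    · rfl
    · exact absurd hij hay.ne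
    · exact absurd hij (hane j)
    · exact absurd hij hne.symm
    · exact absurd hij hay.ne'
    · rfl
    · exact absurd hij (hyne j)
    · exact absurd hij (hve i).ne'
    · exact absurd hij.symm (hane i)
    · exact absurd hij.symm (hyne i)
    · rw [e.injective (Subtype.ext hij)]
/-- A set without independent `(t + m)`-subsets in a graph without induced `K_{t,t}`. -/
lemma card_le_of_completeBipartite_free {V : Type*} [DecidableEq V] {G : SimpleGraph V}
    [DecidableRel G.Adj] {w s : ℕ} (hw1 : 1 ≤ w)
    (hw : ∀ Q : Finset V, G.IsClique (Q : Set V) → Q.card ≤ w)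
    (hK : InducedFree (completeBipartiteGraph (Fin (s + 1)) (Fin (s + 1))) G) (m : ℕ) :
    ∀ A : Finset V, (∀ I ⊆ A, I.card = s + 1 + m → ¬ G.IsIndepSet (I : Set V)) →
      A.card ≤ (s + 3) ^ m * (s * w ^ s + 1) := by
  induction m with
  | zero =>
    intro A hA
    have := card_le_mul_pow_of_not_isIndepSet hw1 hw s A hA
    simp only [pow_zero, one_mul]
    omega
  | succ m ih =>
    intro A hA
    by_cases hT : ∃ T ⊆ A, T.card = s + 1 ∧ G.IsIndepSet (T : Set V)
    · obtain ⟨T, hTA, hTc, hTi⟩ := hT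
      -- Here `t = s + 1`. An independent `t`-set of common neighbours of `T` would complete a
      -- `K_{t,t}`, so the exponent stays `s` whatever `m` is.
      have hcom : (A.filter fun x => ∀ y ∈ T, G.Adj y x).card ≤ s * w ^ s := by
        refine card_le_mul_pow_of_not_isIndepSet hw1 hw s _ fun I hI hIc hIi => ?_
        exact hK.not_completeBipartite hTc hIc hTi hIi
          fun x hx y hy => (Finset.mem_filter.1 (hI hy)).2 x hx
      have hnon : ∀ q ∈ T, (A.filter fun x => ¬ G.Adj q x).card ≤
          (s + 3) ^ m * (s * w ^ s + 1) + 1 := by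
        intro q hq
        have hq' : q ∈ A.filter fun x => ¬ G.Adj q x := by simp [hTA hq]
        rw [← Finset.card_erase_add_one hq']
        gcongr
        refine ih _ fun I hI hIc hind => ?_
        have hqI : q ∉ I := fun h => (Finset.mem_erase.1 (hI h)).1 rfl
        refine hA (insert q I) ?_ (by rw [Finset.card_insert_of_notMem hqI, hIc]; ring) ?_
        · refine Finset.insert_subset (hTA hq) fun x hx => ?_
          exact (Finset.mem_filter.1 (Finset.mem_erase.1 (hI hx)).2).1
        · exact isIndepSet_coe_insert hind
            fun b hb => (Finset.mem_filter.1 (Finset.mem_erase.1 (hI hb)).2).2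
      have hsub : A ⊆ (A.filter fun x => ∀ y ∈ T, G.Adj y x) ∪
          T.biUnion fun q => A.filter fun x => ¬ G.Adj q x := by
        intro x hx
        simp only [Finset.mem_union, Finset.mem_biUnion, Finset.mem_filter]
        by_cases h : ∀ y ∈ T, G.Adj y x
        · exact Or.inl ⟨hx, h⟩
        · push Not at h
          obtain ⟨q, hq, hqx⟩ := h
          exact Or.inr ⟨q, hq, hx, hqx⟩
      have h1 := (Finset.card_le_card hsub).trans (Finset.card_union_le _ _)
      have h2 := Finset.card_biUnion_le_card_mul _ _ _ hnon
      rw [hTc] at h2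
      have h3 : s * w ^ s + 1 ≤ (s + 3) ^ m * (s * w ^ s + 1) :=
        Nat.le_mul_of_pos_left _ (by positivity)
      have h4 : s + 1 ≤ (s + 3) ^ m * (s * w ^ s + 1) + 1 := by
        have : s ≤ s * w ^ s := Nat.le_mul_of_pos_right _ (by positivity)
        omega
      -- The factor `s + 3` counts the `s + 1` vertices of `T`, plus two to absorb the common
      -- neighbours and the additive ones.
      calc A.card ≤ s * w ^ s + (s + 1) * ((s + 3) ^ m * (s * w ^ s + 1) + 1) := by omega
        _ ≤ (s + 3) ^ m * (s * w ^ s + 1) * (s + 3) := by linarith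
        _ = (s + 3) ^ (m + 1) * (s * w ^ s + 1) := by ring
    · push Not at hT
      have h1 := card_le_mul_pow_of_not_isIndepSet hw1 hw s A hT
      have h2 : 1 ≤ (s + 3) ^ (m + 1) := Nat.one_le_pow _ _ (by omega)
      nlinarith

/-! ### The minimum-degree bound -/

/-- Every finite set of vertices of a graph without induced `t`-brooms and `K_{t,t}` has a vertex
with few neighbours in the set. -/
lemma exists_card_adj_le {V : Type*} [DecidableEq V] {G : SimpleGraph V}
    [DecidableRel G.Adj] {w s : ℕ} (hw1 : 1 ≤ w)
    (hw : ∀ Q : Finset V, G.IsClique (Q : Set V) → Q.card ≤ w)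
    (hB : InducedFree (broom (s + 2)) G)
    (hK : InducedFree (completeBipartiteGraph (Fin (s + 2)) (Fin (s + 2))) G)
    {A : Finset V} (hA : A.Nonempty) :
    ∃ v ∈ A, (A.filter (G.Adj v)).card ≤
      ((s + 4) ^ (s + 1) * (s + 2) + (2 * s + 3).choose (s + 2) * (2 * s + 1) + 1)
        * w ^ (s + 1) := by
  obtain ⟨v, hv, hmin⟩ := Finset.exists_min_image A (fun v => (A.filter (G.Adj v)).card) hA
  refine ⟨v, hv, ?_⟩
  set N := A.filter (G.Adj v) with hN
  have hwp : 1 ≤ w ^ (s + 1) := Nat.one_le_pow _ _ hw1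
  -- With `t = s + 2`, the size is `2t - 1`: fewer than `t` neighbours in `S` leaves at least `t`
  -- non-neighbours.
  by_cases hS : ∃ S ⊆ N, S.card = s + 1 + 1 + (s + 1) ∧ G.IsIndepSet (S : Set V)
  · obtain ⟨S, hSN, hSc, hSi⟩ := hS
    have hvS : ∀ x ∈ S, G.Adj v x := fun x hx => (Finset.mem_filter.1 (hSN hx)).2
    -- a vertex with fewer than `t` neighbours in `S` has `t` non-neighbours there
    have hnon : ∀ y, (S.filter (G.Adj y)).card < s + 2 →
        ∃ T ⊆ S, T.card = s + 2 ∧ ∀ x ∈ T, ¬ G.Adj y x := by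
      intro y hy
      have h := Finset.card_filter_add_card_filter_not (s := S) (G.Adj y)
      obtain ⟨T, hT, hTc⟩ := Finset.exists_subset_card_eq
        (show s + 2 ≤ (S.filter fun x => ¬ G.Adj y x).card by omega)
      exact ⟨T, hT.trans (Finset.filter_subset _ _), hTc,
        fun x hx => (Finset.mem_filter.1 (hT hx)).2⟩
    set C := A.filter fun y => y ≠ v ∧ ¬ G.Adj v y ∧ ∃ a ∈ S, G.Adj a y with hC
    set X := N.filter fun x => ∃ y ∈ A, G.Adj x y ∧ y ≠ v ∧ ¬ G.Adj v y ∧ y ∉ C with hX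
    have hCc : C.card ≤ (2 * s + 3).choose (s + 2) * (s * w ^ s) := by
      rw [show 2 * s + 3 = S.card by omega]
      refine card_le_choose_mul_of_many_adj (G := G) ?_ ?_
      · intro y hy
        obtain ⟨-, hyv, hvy, a, ha, hay⟩ := Finset.mem_filter.1 hy
        by_contra! hlt
        obtain ⟨T, hTS, hTc, hTy⟩ := hnon y hlt
        refine hB.not_broom hTc (hSi.mono hTS) (hvS a ha) hay hvy hyv.symm
          (fun x hx => hvS x (hTS hx)) (fun x hx hax => hSi ha (hTS hx) hax.ne hax) hTy
      · intro T hTS hTc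
        refine card_le_mul_pow_of_not_isIndepSet hw1 hw s _ fun I hI hIc hIi => ?_
        have hI' : ∀ y ∈ I, (y ≠ v ∧ ¬ G.Adj v y) ∧ ∀ x ∈ T, G.Adj y x := by
          intro y hy
          obtain ⟨h1, h2⟩ := Finset.mem_filter.1 (hI hy)
          obtain ⟨-, h3, h4, -⟩ := Finset.mem_filter.1 h1
          exact ⟨⟨h3, h4⟩, h2⟩
        -- Adding `v` to `I` supplies the `t`-th vertex of a side of `K_{t,t}`. This saves a factor
        -- `w` in the bound on `C`, which is spent in `hD`.
        have hvI : v ∉ I := fun h => (hI' v h).1.1 rfl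
        refine hK.not_completeBipartite (S := insert v I) (T := T)
          (by rw [Finset.card_insert_of_notMem hvI, hIc]) hTc ?_ (hSi.mono hTS) ?_
        · exact isIndepSet_coe_insert hIi fun b hb => (hI' b hb).1.2
        · intro x hx y hy
          rcases Finset.mem_insert.1 hx with rfl | hx
          · exact hvS y (hTS hy)
          · exact (hI' x hx).2 y hy
    have hXc : X.card ≤ (2 * s + 3).choose (s + 2) * ((s + 1) * w ^ (s + 1)) := by
      rw [show 2 * s + 3 = S.card by omega]
      refine card_le_choose_mul_of_many_adj (G := G) ?_ ?_
      · intro x hx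
        obtain ⟨hxN, y, hyA, hxy, hyv, hvy, hyC⟩ := Finset.mem_filter.1 hx
        by_contra! hlt
        obtain ⟨T, hTS, hTc, hTx⟩ := hnon x hlt
        refine hB.not_broom hTc (hSi.mono hTS) (Finset.mem_filter.1 hxN).2 hxy hvy hyv.symm
          (fun z hz => hvS z (hTS hz)) hTx fun z hz hyz => hyC ?_
        exact Finset.mem_filter.2 ⟨hyA, hyv, hvy, z, hTS hz, hyz.symm⟩
      · intro T hTS hTc
        refine card_le_mul_pow_of_not_isIndepSet hw1 hw (s + 1) _ fun I hI hIc hIi => ?_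
        exact hK.not_completeBipartite hIc hTc hIi (hSi.mono hTS)
          fun x hx y hy => (Finset.mem_filter.1 (hI hx)).2 y hy
    have hD : (N \ X).card ≤ w * (C.card + 1) := by
      refine card_le_mul_of_card_not_adj_le hw fun x hx => ?_
      obtain ⟨hxN, hxX⟩ := Finset.mem_sdiff.1 hx
      obtain ⟨hxA, hvx⟩ := Finset.mem_filter.1 hxN
      have hsub : A.filter (G.Adj x) ⊆ N.filter (G.Adj x) ∪ insert v C := by
        intro y hy
        obtain ⟨hyA, hxy⟩ := Finset.mem_filter.1 hy
        by_contra hcon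
        simp only [Finset.mem_union, Finset.mem_insert, Finset.mem_filter, not_or, hN,
          not_and] at hcon
        refine hxX (Finset.mem_filter.2 ⟨hxN, y, hyA, hxy, hcon.2.1, fun hvy => ?_, hcon.2.2⟩)
        exact hcon.1 ⟨hyA, hvy⟩ hxy
      -- Minimality of the degree of `v` gives `|N| ≤ deg x`, so the neighbours of `x` in `N` number
      -- at least `|N| - |C| - 1`.
      have h1 := (hmin x hxA).trans (Finset.card_le_card hsub)
      have h2 := Finset.card_union_le (N.filter (G.Adj x)) (insert v C)
      have h3 := Finset.card_insert_le v C
      have h4 := Finset.card_filter_add_card_filter_not (s := N) (G.Adj x)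
      have h5 : ((N \ X).filter fun y => ¬ G.Adj x y).card ≤
          (N.filter fun y => ¬ G.Adj x y).card :=
        Finset.card_le_card (Finset.filter_subset_filter _ Finset.sdiff_subset)
      omega
    have hNc : N.card ≤ (N \ X).card + X.card := by
      rw [Finset.card_sdiff_add_card_eq_card (Finset.filter_subset _ _)]
    calc N.card ≤ w * ((2 * s + 3).choose (s + 2) * (s * w ^ s) + 1) +
          (2 * s + 3).choose (s + 2) * ((s + 1) * w ^ (s + 1)) := by
          refine hNc.trans (Nat.add_le_add (hD.trans ?_) hXc)
          gcongr
      _ = (2 * s + 3).choose (s + 2) * (2 * s + 1) * w ^ (s + 1) + w ^ 1 := by ring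
      _ ≤ (2 * s + 3).choose (s + 2) * (2 * s + 1) * w ^ (s + 1) + w ^ (s + 1) := by
          exact Nat.add_le_add_left (Nat.pow_le_pow_right hw1 (by omega)) _
      _ ≤ _ := by nlinarith [Nat.zero_le ((s + 4) ^ (s + 1) * (s + 2) * w ^ (s + 1))]
  · push Not at hS
    have h := card_le_of_completeBipartite_free hw1 hw hK (s + 1) N hS
    calc N.card ≤ (s + 1 + 3) ^ (s + 1) * ((s + 1) * w ^ (s + 1) + 1) := h
      _ ≤ (s + 4) ^ (s + 1) * ((s + 1) * w ^ (s + 1) + w ^ (s + 1)) := by gcongr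
      _ = (s + 4) ^ (s + 1) * (s + 2) * w ^ (s + 1) := by ring
      _ ≤ _ := by gcongr; omega

/-! ### Colouring and asymptotics -/

/-- Greedy colouring of a `k`-degenerate graph. -/
lemma colorable_of_degenerate {V : Type*} [Finite V] [DecidableEq V] {G : SimpleGraph V}
    [DecidableRel G.Adj] {k : ℕ}
    (h : ∀ A : Finset V, A.Nonempty → ∃ v ∈ A, (A.filter (G.Adj v)).card ≤ k) :
    G.Colorable (k + 1) := by
  have key : ∀ (n : ℕ) (A : Finset V), A.card = n →
      ∃ c : V → Fin (k + 1), ∀ x ∈ A, ∀ y ∈ A, G.Adj x y → c x ≠ c y := by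
    intro n
    induction n with
    | zero =>
      intro A hA
      rw [Finset.card_eq_zero] at hA
      exact ⟨fun _ => 0, by simp [hA]⟩
    | succ n ih =>
      intro A hA
      obtain ⟨v, hv, hvk⟩ := h A (Finset.card_pos.1 (by omega))
      obtain ⟨c, hc⟩ := ih (A.erase v) (by rw [Finset.card_erase_of_mem hv]; omega)
      -- The at most `k` neighbours of `v` in `A` cannot use all `k + 1` colours.
      obtain ⟨i, hi⟩ : ∃ i, i ∉ (A.filter (G.Adj v)).image c := by
        by_contra! hall
        have h1 := Finset.card_le_card (fun i _ => hall i :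
          (Finset.univ : Finset (Fin (k + 1))) ⊆ _)
        rw [Finset.card_univ, Fintype.card_fin] at h1
        exact absurd (h1.trans Finset.card_image_le) (by omega)
      have hiv : ∀ y ∈ A, G.Adj v y → i ≠ c y := fun y hy hvy hiy =>
        hi (Finset.mem_image.2 ⟨y, Finset.mem_filter.2 ⟨hy, hvy⟩, hiy.symm⟩)
      refine ⟨Function.update c v i, fun x hx y hy hxy => ?_⟩
      by_cases hxv : x = v
      · subst hxv
        rw [Function.update_self, Function.update_of_ne hxy.ne']
        exact hiv y hy hxy
      · by_cases hyv : y = v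
        · subst hyv
          rw [Function.update_self, Function.update_of_ne hxv]
          exact (hiv x hx hxy.symm).symm
        · rw [Function.update_of_ne hxv, Function.update_of_ne hyv]
          exact hc x (Finset.mem_erase.2 ⟨hxv, hx⟩) y (Finset.mem_erase.2 ⟨hyv, hy⟩) hxy
  have := Fintype.ofFinite V
  obtain ⟨c, hc⟩ := key _ Finset.univ rfl
  exact ⟨SimpleGraph.Coloring.mk c fun {x y} hxy =>
    hc x (Finset.mem_univ x) y (Finset.mem_univ y) hxy⟩

lemma isLittleO_rpow_rpow_atTop_of_lt {p q : ℝ} (h : p < q) :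
    (fun x : ℝ => x ^ p) =o[atTop] (fun x : ℝ => x ^ q) := by
  refine (isLittleO_iff_tendsto' ?_).2 ?_
  · filter_upwards [eventually_gt_atTop 0] with x hx h0
    exact absurd h0 (Real.rpow_pos_of_pos hx q).ne'
  · refine (tendsto_rpow_neg_atTop (sub_pos.2 h)).congr' ?_
    filter_upwards [eventually_gt_atTop 0] with x hx
    rw [← Real.rpow_sub hx, neg_sub]

theorem theorem3 (t : ℕ) (ht : 3 ≤ t) :
    ∃ g : ℕ → ℕ,
      (fun n : ℕ => (g n : ℝ)) =o[atTop]
        (fun n : ℕ => (n : ℝ) ^ ((t : ℝ) - 1 + 2 / ((t : ℝ) + 1))) ∧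
      ∀ (V : Type*) [Finite V] (G : SimpleGraph V),
        InducedFree (broom t) G →
        InducedFree (completeBipartiteGraph (Fin t) (Fin t)) G →
          G.chromaticNumber ≤ (g G.cliqueNum : ℕ∞) := by
  obtain ⟨s, rfl⟩ := Nat.exists_eq_add_of_le' (show 2 ≤ t by omega)
  set K := (s + 4) ^ (s + 1) * (s + 2) + (2 * s + 3).choose (s + 2) * (2 * s + 1) + 1 with hKdef
  refine ⟨fun n => K * n ^ (s + 1) + 1, ?_, ?_⟩
  · have hpos : (0 : ℝ) < 2 / (((s + 2 : ℕ) : ℝ) + 1) := by positivity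
    have hlit : ∀ p : ℝ, p < ((s + 2 : ℕ) : ℝ) - 1 + 2 / (((s + 2 : ℕ) : ℝ) + 1) →
        (fun n : ℕ => (n : ℝ) ^ p) =o[atTop]
          (fun n : ℕ => (n : ℝ) ^ (((s + 2 : ℕ) : ℝ) - 1 + 2 / (((s + 2 : ℕ) : ℝ) + 1))) :=
      fun p hp => (isLittleO_rpow_rpow_atTop_of_lt hp).comp_tendsto tendsto_natCast_atTop_atTop
    have h1 := (hlit ((s + 1 : ℕ) : ℝ) (by push_cast at hpos ⊢; linarith)).const_mul_left (K : ℝ)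
    have h2 := hlit 0 (by push_cast at hpos ⊢; linarith)
    refine (h1.add h2).congr_left fun n => ?_
    rw [Real.rpow_natCast, Real.rpow_zero]
    push_cast
    ring
  · intro V _ G hB hK
    classical
    have := Fintype.ofFinite V
    refine SimpleGraph.Colorable.chromaticNumber_le (colorable_of_degenerate fun A hA => ?_)
    have hw : ∀ Q : Finset V, G.IsClique (Q : Set V) → Q.card ≤ G.cliqueNum :=
      fun Q hQ => hQ.card_le_cliqueNum
    -- A vertex of `A` is a clique of size one; the empty graph never reaches this point.
    have hw1 : 1 ≤ G.cliqueNum := by simpa using hw {hA.choose} (by simp)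
    exact exists_card_adj_le hw1 hw hB hK hA
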